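/- **Setting.** Let $X\in\mathbb R^{n\times d}$ have rows (observations) $x^{(1)},\dots,x^{(n)}$ and columns (features) $x_1,\dots,x_d$. Let $L>0$ and let $f_1,\dots,f_n:\mathbb R^q\to\mathbb R$ be convex and differentiable with $\frac1L$-Lipschitz gradients. Let $\lambda_1\ge\lambda_2\ge\dots\ge\lambda_d\ge 0$. For $B\in\mathbb R^{d\times q}$ put $$F(B)=\sum_{j=1}^n f_j\big((XB)_{j,:}\big),\qquad P_\lambda(B)=F(B)+\sum_{i=1}^d\lambda_i\|B_{[i],:}\|_2,$$ where $\|B_{[1],:}\|_2\ge\dots\ge\|B_{[d],:}\|_2$ are the row norms of $B$ in non-increasing order (Group OWL model). For $\Theta\in\mathbb R^{n\times q}$ let $D(\Theta)=-\sum_{j=1}^n f_j^\star(\Theta_{j,:})\in[-\infty,\infty)$ with the convex conjugates $f_j^\star(\theta)=\sup_z(\langle z,\theta\rangle-f_j(z))$, and let $G(B,\Theta)=P_\lambda(B)-D(\Theta)$ be the duality gap. For $A\subseteq\{1,\dots,d\}$ call $\Theta$ *dual feasible on* $A$ if for every $m=1,\dots,|A|$ the sum of the $m$ largest of the numbers $\|x_i^\top\Theta\|_2$,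 $i\in A$, is at most $\lambda_1+\dots+\lambda_m$. (For $A=\{1,\dots,d\}$ this is the constraint of the dual problem of the full model; for smaller $A$ it is weaker.) **Screening rule.** Start with $A_0=\{1,\dots,d\}$. At pass $t=0,1,2,\dots$ an iterative algorithm holds a primal matrix $B^t\in\mathbb R^{d\times q}$ and a matrix $\Theta^t\in\mathbb R^{n\times q}$ that is dual feasible on $A_t$; otherwise $B^t,\Theta^t$ are arbitrary (they may depend in any way on what happened before, and may stay the same over several passes). The rule discards every $i\in A_t$ for which $G(B^t,\Theta^t)<\infty$ and $$\|x_i^\top\Theta^t\|_2+\|x_i\|_2\sqrt{2G(B^t,\Theta^t)/L}<\lambda_{|A_t|},$$ and $A_{t+1}$ is the set of the features of $A_t$ that are not discarded. **Claim.** Suppose that $P_\lambda$ attains its minimum. Then the rule is safe at every time $t$, whatever the algorithm: 1. For every minimizer $B^*$ of $P_\lambda$ and every discarded feature $i\notin A_t$, $B^*_{i,:}=0$. 2. The reassignment of the smallest weights to the discarded features does not change the model: for every bijection $\tau$ from the complement of $A_t$ onto $\{|A_t|+1,\dots,d\}$, the minimizers of $P_\lambda$ over $\mathbb R^{d\times q}$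 are exactly the minimizers, over all $B$ with $B_{i,:}=0$ for every $i\notin A_t$, of $$F(B)+\sum_{k=1}^{|A_t|}\lambda_k\|B_{[k]_{A_t},:}\|_2+\sum_{i\notin A_t}\lambda_{\tau(i)}\|B_{i,:}\|_2,$$ where $\|B_{[1]_{A},:}\|_2\ge\dots\ge\|B_{[|A|]_{A},:}\|_2$ are the norms of the rows $B_{i,:}$, $i\in A$, in non-increasing order. -/

import Mathlib

open Finset

namespace GroupOWL

noncomputable section

/-- The Euclidean norm `‖M_{i,:}‖₂` of the `i`-th row of a matrix. -/
def rowNorm {m q : ℕ} (M : Matrix (Fin m) (Fin q) ℝ) (i : Fin m) : ℝ :=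
  ‖(WithLp.toLp 2 (M i) : EuclideanSpace ℝ (Fin q))‖

/-- The non-increasing rearrangement `v_[1] ≥ v_[2] ≥ ⋯ ≥ v_[m]` of a vector. -/
def sortedDesc {m : ℕ} (v : Fin m → ℝ) : Fin m → ℝ :=
  v ∘ Tuple.sort (fun i => -v i)

/-- The ordered weighted sum `∑ j, w_j v_[j]`. -/
def owlSum {m : ℕ} (w v : Fin m → ℝ) : ℝ :=
  ∑ j, w j * sortedDesc v j

/-- The `|A|` largest weights `λ_1, …, λ_{|A|}`, which are the weights of the features in `A`. -/
def topWeights {d : ℕ} (lam : Fin d → ℝ) (A : Finset (Fin d)) : Fin A.card → ℝ :=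
  fun j => lam (Fin.castLE (by simpa using A.card_le_univ) j)

/-- The subvector `v_A` of a vector `v`. -/
def subvector {d : ℕ} (A : Finset (Fin d)) (v : Fin d → ℝ) : Fin A.card → ℝ :=
  fun j => v (A.orderEmbOfFin rfl j)

/-- The loss `F(B) = ∑ j, f_j(x_jᵀ B)`; here `x_jᵀ` is the `j`-th row (observation) of `X`. -/
def loss {n d q : ℕ} (X : Matrix (Fin n) (Fin d) ℝ)
    (f : Fin n → EuclideanSpace ℝ (Fin q) → ℝ) (B : Matrix (Fin d) (Fin q) ℝ) : ℝ :=
  ∑ j, f j (WithLp.toLp 2 ((X * B) j))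

/-- The Group OWL objective `P_λ(B) = F(B) + ∑ i, λ_i ‖B_{[i],:}‖₂`. -/
def primal {n d q : ℕ} (X : Matrix (Fin n) (Fin d) ℝ)
    (f : Fin n → EuclideanSpace ℝ (Fin q) → ℝ) (lam : Fin d → ℝ)
    (B : Matrix (Fin d) (Fin q) ℝ) : ℝ :=
  loss X f B + owlSum lam (rowNorm B)

/-- The convex conjugate `f⋆(θ) = sup_z (⟨z, θ⟩ - f z)`, with values in the extended reals. -/
def conjugate {q : ℕ} (f : EuclideanSpace ℝ (Fin q) → ℝ) (θ : EuclideanSpace ℝ (Fin q)) : EReal :=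
  ⨆ z : EuclideanSpace ℝ (Fin q), ((inner ℝ z θ - f z : ℝ) : EReal)

/-- The dual objective `D(Θ) = ∑ j, -f_j⋆(Θ_{j,:})`, which may be `-∞`. -/
def dual {n q : ℕ} (f : Fin n → EuclideanSpace ℝ (Fin q) → ℝ)
    (Θ : Matrix (Fin n) (Fin q) ℝ) : EReal :=
  ∑ j, -conjugate (f j) (WithLp.toLp 2 (Θ j))

/-- The duality gap `G(B, Θ) = P_λ(B) - D(Θ)`; it is `+∞` when `D(Θ) = -∞`. -/
def gap {n d q : ℕ} (X : Matrix (Fin n) (Fin d) ℝ)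
    (f : Fin n → EuclideanSpace ℝ (Fin q) → ℝ) (lam : Fin d → ℝ)
    (B : Matrix (Fin d) (Fin q) ℝ) (Θ : Matrix (Fin n) (Fin q) ℝ) : EReal :=
  (primal X f lam B : EReal) - dual f Θ

/-- The dual constraint of the Group OWL model on the features in `A` with the weights
`λ_1, …, λ_{|A|}`: the sum of the `m` largest of the numbers `‖x_iᵀ Θ‖₂`, `i ∈ A`, is at most
`λ_1 + ⋯ + λ_m`, for `m = 1, …, |A|`.  Here `x_i` is the `i`-th column (feature) of `X`.
For `A = univ` this is the constraint `Θ ∈ Δ` of the full dual problem, and it becomes weaker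
as `A` shrinks. -/
def DualFeasible {n d q : ℕ} (X : Matrix (Fin n) (Fin d) ℝ) (lam : Fin d → ℝ)
    (A : Finset (Fin d)) (Θ : Matrix (Fin n) (Fin q) ℝ) : Prop :=
  ∀ m : Fin A.card,
    ∑ j ∈ Iic m, sortedDesc (subvector A (rowNorm (X.transpose * Θ))) j
      ≤ ∑ j ∈ Iic m, topWeights lam A j

/-- The weight `λ_{|A|}` of the screening test, where the weights are numbered `1, …, d` (so it has
the index `|A| - 1` in `Fin d`).  It is used only for `i ∈ A`, so that `1 ≤ |A| ≤ d`. -/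
def testWeight {d : ℕ} (lam : Fin d → ℝ) (A : Finset (Fin d)) (i : Fin d) : ℝ :=
  lam ⟨A.card - 1, by
    have h : A.card ≤ d := by simpa using A.card_le_univ
    have := i.pos
    omega⟩

/-- The screening test `‖x_iᵀ Θ‖₂ + ‖x_i‖ √(2 G(B, Θ) / L) < λ_{|A|}` for feature `i`
(never satisfied when the gap is infinite). -/
def ScreeningTest {n d q : ℕ} (X : Matrix (Fin n) (Fin d) ℝ)
    (f : Fin n → EuclideanSpace ℝ (Fin q) → ℝ) (L : ℝ) (lam : Fin d → ℝ)
    (A : Finset (Fin d)) (B : Matrix (Fin d) (Fin q) ℝ) (Θ : Matrix (Fin n) (Fin q) ℝ)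
    (i : Fin d) : Prop :=
  ∃ g : ℝ, gap X f lam B Θ = (g : EReal) ∧
    rowNorm (X.transpose * Θ) i + rowNorm X.transpose i * Real.sqrt (2 * g / L)
      < testWeight lam A i

open Classical in
/-- One pass of the screening rule: every feature of `A` that satisfies the test is discarded. -/
def screen {n d q : ℕ} (X : Matrix (Fin n) (Fin d) ℝ)
    (f : Fin n → EuclideanSpace ℝ (Fin q) → ℝ) (L : ℝ) (lam : Fin d → ℝ)
    (B : Matrix (Fin d) (Fin q) ℝ) (Θ : Matrix (Fin n) (Fin q) ℝ)
    (A : Finset (Fin d)) : Finset (Fin d) :=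
  A.filter (fun i => ¬ ScreeningTest X f L lam A B Θ i)

/-- The active set after `t` passes of the screening rule, where pass number `t` uses the primal
iterate `B t` and the dual iterate `Θ t`.  The two sequences are arbitrary (they may depend on the
earlier active sets, on random choices, …), so they stand for the iterates that any iterative
algorithm holds at the successive passes; the repetition of passes within one iteration of the
algorithm is the case of a pair that stays the same (or is merely restricted to the remaining
features) for several consecutive `t`. -/
def activeSet {n d q : ℕ} (X : Matrix (Fin n) (Fin d) ℝ)
    (f : Fin n → EuclideanSpace ℝ (Fin q) → ℝ) (L : ℝ) (lam : Fin d → ℝ)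
    (B : ℕ → Matrix (Fin d) (Fin q) ℝ) (Θ : ℕ → Matrix (Fin n) (Fin q) ℝ) :
    ℕ → Finset (Fin d)
  | 0 => univ
  | t + 1 => screen X f L lam (B t) (Θ t) (activeSet X f L lam B Θ t)

/-- The coefficient matrices whose rows outside `A` vanish: the search space after the features
outside `A` have been discarded. -/
def supportedOn {d : ℕ} (q : ℕ) (A : Finset (Fin d)) : Set (Matrix (Fin d) (Fin q) ℝ) :=
  {B | ∀ i, i ∉ A → B i = 0}

/-- The objective in which the features in `A` carry the ordered weights `λ_1, …, λ_{|A|}` and each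
feature `i` outside `A` has been assigned the fixed weight `λ_{τ i}`. -/
def reassigned {n d q : ℕ} (X : Matrix (Fin n) (Fin d) ℝ)
    (f : Fin n → EuclideanSpace ℝ (Fin q) → ℝ) (lam : Fin d → ℝ)
    (A : Finset (Fin d)) (τ : Equiv.Perm (Fin d)) (B : Matrix (Fin d) (Fin q) ℝ) : ℝ :=
  loss X f B + owlSum (topWeights lam A) (subvector A (rowNorm B))
    + ∑ i ∈ Aᶜ, lam (τ i) * rowNorm B i

end

end GroupOWL

/-! By induction on `t`, every minimizer $C$ of the full objective vanishes outside $A_t$. Suppose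
it does, and write $A=A_t$. The penalty of $C$ then involves only $\lambda_1,\dots,\lambda_{|A|}$,
so the weaker constraint on $A$ still gives weak duality for $C$ (`neg_owlSum_le_sum_inner`).
Smoothness of the $f_j$ adds a quadratic term to the Fenchel–Young inequality
(`exists_inner_sub_ge`). With $P_\lambda(C)\le P_\lambda(B)$ this puts $\Theta$ within $\sqrt{2G/L}$
of the gradients at $C$, in Frobenius norm. By Cauchy–Schwarz, the test forces the correlation of
$x_i$ with these gradients below $\lambda_{|A|}$.

Such a feature has zero row in $C$ (`row_eq_zero_of_rowNorm_lt`): shrinking a nonzero row by a small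
factor would save more penalty, at rate at least $\lambda_{|A|}$, than it costs in loss. Only
comparison with perturbed points is used, neither subdifferentials nor a dual optimum.

For the second claim, the two objectives agree on matrices supported on $A_t$, which contain all the
minimizers. -/

namespace GroupOWL

/-! ### Rearrangement inequalities for ordered weighted sums -/

section OrderedWeights

variable {m : ℕ}

lemma antitone_sortedDesc (v : Fin m → ℝ) : Antitone (sortedDesc v) := by
  intro i j hij
  have := Tuple.monotone_sort (fun i => -v i) hij
  simpa [sortedDesc] using this

lemma sortedDesc_eq_of_antitone {v : Fin m → ℝ} {σ : Equiv.Perm (Fin m)}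
    (h : Antitone (v ∘ σ)) : sortedDesc v = v ∘ σ :=
  Tuple.unique_antitone (antitone_sortedDesc v) h

lemma sum_sortedDesc (v : Fin m → ℝ) : ∑ j, sortedDesc v j = ∑ j, v j :=
  Equiv.sum_comp (Tuple.sort (fun i => -v i)) v

/-- Rearrangement: pairing two vectors is at most pairing their sorted versions. -/
lemma sum_mul_le_sum_sortedDesc_mul (v u : Fin m → ℝ) :
    ∑ i, v i * u i ≤ ∑ j, sortedDesc v j * sortedDesc u j := by
  set σ := Tuple.sort (fun i => -v i)
  set ρ := Tuple.sort (fun i => -u i)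
  have hmono : Monovary (sortedDesc v) (sortedDesc u) :=
    (antitone_sortedDesc v).monovary (antitone_sortedDesc u)
  have h := hmono.sum_mul_comp_perm_le_sum_mul (σ := σ.trans ρ.symm)
  refine le_of_eq_of_le ?_ h
  rw [← Equiv.sum_comp σ]
  simp [sortedDesc, σ, ρ]

lemma sum_mul_comp_perm_le_owlSum {w : Fin m → ℝ} (hw : Antitone w) (v : Fin m → ℝ)
    (σ : Equiv.Perm (Fin m)) : ∑ j, w j * v (σ j) ≤ owlSum w v := by
  set ρ := Tuple.sort (fun i => -v i)
  have h := (hw.monovary (antitone_sortedDesc v)).sum_mul_comp_perm_le_sum_mul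
    (σ := σ.trans ρ.symm)
  refine le_of_eq_of_le ?_ h
  simp [sortedDesc, ρ]

lemma owlSum_mono {w : Fin m → ℝ} (hw : Antitone w) (hw0 : ∀ j, 0 ≤ w j) {v v' : Fin m → ℝ}
    (h : ∀ j, v j ≤ v' j) : owlSum w v ≤ owlSum w v' :=
  (sum_le_sum fun j _ => mul_le_mul_of_nonneg_left (h _) (hw0 j)).trans
    (sum_mul_comp_perm_le_owlSum hw v' _)

/-- If all weights are at least `c`, decreasing the entries of a vector decreases the ordered
weighted sum at least by `c` times the decrease of the sum. -/
lemma owlSum_add_mul_le {w : Fin m → ℝ} (hw : Antitone w) {c : ℝ} (hc : ∀ j, c ≤ w j)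
    {v v' : Fin m → ℝ} (h : ∀ j, v j ≤ v' j) :
    owlSum w v + c * (∑ j, v' j - ∑ j, v j) ≤ owlSum w v' := by
  -- The constant part `c` of the weights does not see the ordering; the remaining weights are still
  -- nonnegative and sorted, so monotonicity applies to them.
  have key : ∀ u : Fin m → ℝ, owlSum w u = owlSum (fun j => w j - c) u + c * ∑ j, u j := by
    intro u
    rw [← sum_sortedDesc u, owlSum, owlSum, mul_sum, ← sum_add_distrib]
    exact sum_congr rfl fun j _ => by ring
  have := owlSum_mono (w := fun j => w j - c) (fun i j hij => sub_le_sub_right (hw hij) c)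
    (fun j => sub_nonneg.2 (hc j)) h
  rw [key v, key v']
  linarith

/-- Summation by parts against a nonnegative non-increasing sequence. -/
lemma sum_mul_nonneg_of_antitone : ∀ {m : ℕ} {v a : Fin m → ℝ}, Antitone v → (∀ j, 0 ≤ v j) →
    (∀ k, 0 ≤ ∑ j ∈ Iic k, a j) → 0 ≤ ∑ j, v j * a j
  | 0, _, _, _, _, _ => by simp
  | m + 1, v, a, hv, hv0, ha => by
    -- Subtracting the last value keeps the shorter sequence nonnegative; the part removed pairs
    -- with the total sum of `a`.
    have ih := sum_mul_nonneg_of_antitone (v := fun j : Fin m => v j.castSucc - v (Fin.last m))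
      (a := fun j => a j.castSucc)
      (fun i j hij => sub_le_sub_right (hv (Fin.castSucc_le_castSucc_iff.2 hij)) _)
      (fun j => sub_nonneg.2 (hv (Fin.le_last _)))
      (fun k => by
        have := ha k.castSucc
        rwa [← Fin.map_castSuccEmb_Iic, sum_map] at this)
    have hlast : 0 ≤ ∑ j, a j := by
      have := ha (Fin.last m)
      rwa [← Fin.top_eq_last, Iic_top] at this
    have hmul := mul_nonneg (hv0 (Fin.last m)) hlast
    rw [Fin.sum_univ_castSucc] at hmul ⊢
    simp only [sub_mul, sum_sub_distrib, ← mul_sum] at ih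
    linarith

/-- The ordered weighted sum dominates the pairing with any vector that satisfies the dual
constraint. -/
lemma sum_mul_le_owlSum {w v u : Fin m → ℝ} (hv : ∀ j, 0 ≤ v j)
    (hu : ∀ k, ∑ j ∈ Iic k, sortedDesc u j ≤ ∑ j ∈ Iic k, w j) :
    ∑ j, v j * u j ≤ owlSum w v := by
  have h := sum_mul_nonneg_of_antitone (antitone_sortedDesc v) (a := fun j => w j - sortedDesc u j)
    (fun j => hv _) (fun k => by simpa [sum_sub_distrib] using hu k)
  refine (sum_mul_le_sum_sortedDesc_mul v u).trans ?_
  simp only [mul_sub, sum_sub_distrib, sub_nonneg] at h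
  simpa only [owlSum, mul_comm] using h

end OrderedWeights

/-! ### Restriction to the active features -/

section Subvector

variable {d : ℕ}

lemma sum_subvector (A : Finset (Fin d)) (v : Fin d → ℝ) :
    ∑ j, subvector A v j = ∑ i ∈ A, v i := by
  rw [← Finset.sum_coe_sort A v]
  exact Equiv.sum_comp (A.orderIsoOfFin rfl).toEquiv (fun i : A => v i)

lemma antitone_topWeights {lam : Fin d → ℝ} (hlam : Antitone lam) (A : Finset (Fin d)) :
    Antitone (topWeights lam A) :=
  fun _ _ hij => hlam hij

lemma testWeight_le_topWeights {lam : Fin d → ℝ} (hlam : Antitone lam) (A : Finset (Fin d))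
    (i : Fin d) (j : Fin A.card) : testWeight lam A i ≤ topWeights lam A j :=
  hlam (by
    rw [Fin.le_def]
    exact Nat.le_sub_one_of_lt j.isLt)

/-- For a nonnegative vector supported on `A`, only the `|A|` largest weights matter. -/
lemma owlSum_eq_of_support {A : Finset (Fin d)} {v : Fin d → ℝ} (lam : Fin d → ℝ)
    (hv : ∀ i, 0 ≤ v i) (hA : ∀ i, i ∉ A → v i = 0) :
    owlSum lam v = owlSum (topWeights lam A) (subvector A v) := by
  have hcard : A.card ≤ d := by simpa using A.card_le_univ
  set s := Tuple.sort (fun i => -subvector A v i)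
  -- Sort within `A` on the first `|A|` positions. Any extension to a permutation sends the other
  -- positions outside `A`, where `v` is zero, so it sorts all of `v`.
  let e : {j : Fin d // (j : ℕ) < A.card} ≃ {i // i ∈ A} :=
    (Fin.castLEquiv hcard).symm.trans (s.trans (A.orderIsoOfFin rfl).toEquiv)
  have hlt : ∀ (j : Fin d) (hj : (j : ℕ) < A.card),
      v (e.extendSubtype j) = sortedDesc (subvector A v) ⟨j, hj⟩ := by
    intro j hj
    rw [e.extendSubtype_apply_of_mem j hj]
    rfl
  have hge : ∀ j : Fin d, ¬ (j : ℕ) < A.card → v (e.extendSubtype j) = 0 := fun j hj =>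
    hA _ (e.extendSubtype_not_mem j hj)
  have hanti : Antitone (v ∘ e.extendSubtype) := by
    intro i j hij
    simp only [Function.comp_apply]
    by_cases hj : (j : ℕ) < A.card
    · have hi : (i : ℕ) < A.card := lt_of_le_of_lt hij hj
      rw [hlt i hi, hlt j hj]
      exact antitone_sortedDesc _ hij
    · rw [hge j hj]
      exact hv _
  rw [owlSum, sortedDesc_eq_of_antitone hanti, owlSum]
  symm
  refine sum_of_injOn (Fin.castLE hcard) (Fin.castLE_injective hcard).injOn
    (fun _ _ => mem_coe.2 (mem_univ _)) ?_ ?_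
  · intro j _ hj
    have : ¬ (j : ℕ) < A.card := fun h => hj ⟨⟨j, h⟩, by simp, by ext; simp⟩
    simp [hge j this]
  · intro j _
    simp only [Function.comp_apply]
    rw [hlt (Fin.castLE hcard j) j.isLt]
    rfl

end Subvector

/-! ### Smoothness and the quadratic Fenchel–Young bound -/

section Smooth

variable {E : Type*} [NormedAddCommGroup E] [InnerProductSpace ℝ E] [CompleteSpace E]

/-- Quadratic upper bound for a function with Lipschitz gradient. -/
lemma le_add_inner_gradient_add_sq {f : E → ℝ} {K : ℝ} (hf : Differentiable ℝ f)
    (hlip : ∀ z w, ‖gradient f z - gradient f w‖ ≤ K * ‖z - w‖) (z h : E) :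
    f (z + h) ≤ f z + inner ℝ (gradient f z) h + K / 2 * ‖h‖ ^ 2 := by
  -- The error of the quadratic bound along the segment, up to a constant; the Lipschitz condition
  -- makes its derivative nonpositive.
  let φ : ℝ → ℝ := fun t =>
    f (z + t • h) - t * inner ℝ (gradient f z) h - K / 2 * t ^ 2 * ‖h‖ ^ 2
  have hderiv : ∀ t, HasDerivAt φ
      (inner ℝ (gradient f (z + t • h)) h - inner ℝ (gradient f z) h - K * t * ‖h‖ ^ 2) t := by
    intro t
    have h1 : HasDerivAt (fun t : ℝ => z + t • h) h t := by
      simpa using ((hasDerivAt_id t).smul_const h).const_add z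
    have h2 := (hf (z + t • h)).hasFDerivAt.comp_hasDerivAt t h1
    rw [← inner_gradient_left] at h2
    have h3 := (hasDerivAt_id t).mul_const (inner ℝ (gradient f z) h)
    have h4 := (((hasDerivAt_id t).pow 2).const_mul (K / 2)).mul_const (‖h‖ ^ 2)
    refine ((h2.sub h3).sub h4).congr_deriv ?_
    simp only [id_eq, Nat.cast_ofNat, Nat.add_one_sub_one, pow_one]
    ring
  have hanti : AntitoneOn φ (Set.Icc 0 1) := by
    refine antitoneOn_of_hasDerivWithinAt_nonpos (convex_Icc 0 1)
      (fun t _ => (hderiv t).continuousAt.continuousWithinAt)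
      (fun t _ => (hderiv t).hasDerivWithinAt) ?_
    intro t ht
    rw [interior_Icc] at ht
    rw [← inner_sub_left]
    have h1 := real_inner_le_norm (gradient f (z + t • h) - gradient f z) h
    have h2 := hlip (z + t • h) z
    rw [add_sub_cancel_left, norm_smul, Real.norm_of_nonneg ht.1.le] at h2
    nlinarith [norm_nonneg h, mul_le_mul_of_nonneg_right h2 (norm_nonneg h)]
  have := hanti (Set.left_mem_Icc.2 zero_le_one) (Set.right_mem_Icc.2 zero_le_one) zero_le_one
  simp [φ, -inner_gradient_left] at this
  linarith

/-- Strong convexity of the conjugate of a function with `1 / L`-Lipschitz gradient, at a gradient: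
some `z` attains the quadratic lower bound of `⟨z, θ⟩ - f z`. -/
lemma exists_inner_sub_ge {f : E → ℝ} {L : ℝ} (hL : 0 < L) (hf : Differentiable ℝ f)
    (hlip : ∀ z w, ‖gradient f z - gradient f w‖ ≤ 1 / L * ‖z - w‖) (z₀ θ : E) :
    ∃ z, inner ℝ z₀ θ - f z₀ + L / 2 * ‖θ - gradient f z₀‖ ^ 2 ≤ inner ℝ z θ - f z := by
  -- This step maximizes the lower bound ⟨h, θ - ∇f z₀⟩ - ‖h‖² / (2L) over h.
  refine ⟨z₀ + L • (θ - gradient f z₀), ?_⟩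
  have h := le_add_inner_gradient_add_sq hf hlip z₀ (L • (θ - gradient f z₀))
  have hsq : ‖θ - gradient f z₀‖ ^ 2 = inner ℝ (θ - gradient f z₀) θ
      - inner ℝ (gradient f z₀) (θ - gradient f z₀) := by
    rw [real_inner_comm, ← inner_sub_left, real_inner_self_eq_norm_sq]
  rw [norm_smul, Real.norm_of_nonneg hL.le, real_inner_smul_right] at h
  rw [inner_add_left, real_inner_smul_left]
  have hK : 1 / L / 2 * (L * ‖θ - gradient f z₀‖) ^ 2 = L / 2 * ‖θ - gradient f z₀‖ ^ 2 := by
    field_simp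
  rw [hK] at h
  have : L * ‖θ - gradient f z₀‖ ^ 2 = L * inner ℝ (θ - gradient f z₀) θ
      - L * inner ℝ (gradient f z₀) (θ - gradient f z₀) := by rw [hsq]; ring
  linarith

end Smooth


/-! ### Row norms and matrix products -/

section Rows

variable {n d q : ℕ}

/-- The `i`-th row of a matrix as a vector of Euclidean space. -/
abbrev row {m : ℕ} (M : Matrix (Fin m) (Fin q) ℝ) (i : Fin m) : EuclideanSpace ℝ (Fin q) :=
  WithLp.toLp 2 (M i)

lemma rowNorm_nonneg {m : ℕ} (M : Matrix (Fin m) (Fin q) ℝ) (i : Fin m) : 0 ≤ rowNorm M i :=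
  norm_nonneg _

lemma rowNorm_eq_zero {m : ℕ} {M : Matrix (Fin m) (Fin q) ℝ} {i : Fin m} :
    rowNorm M i = 0 ↔ M i = 0 := by
  simp [rowNorm]

lemma row_mul (X : Matrix (Fin n) (Fin d) ℝ) (B : Matrix (Fin d) (Fin q) ℝ) (j : Fin n) :
    row (X * B) j = ∑ i, X j i • row B i := by
  ext k
  simp [Matrix.mul_apply]

lemma sum_inner_row_mul (X : Matrix (Fin n) (Fin d) ℝ) (B : Matrix (Fin d) (Fin q) ℝ)
    (Θ : Matrix (Fin n) (Fin q) ℝ) :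
    ∑ j, inner ℝ (row (X * B) j) (row Θ j) = ∑ i, inner ℝ (row B i) (row (X.transpose * Θ) i) := by
  simp only [row_mul, sum_inner, inner_sum, real_inner_smul_left, real_inner_smul_right,
    Matrix.transpose_apply]
  exact sum_comm

lemma rowNorm_transpose_mul_le (X : Matrix (Fin n) (Fin d) ℝ) (M : Matrix (Fin n) (Fin q) ℝ)
    (i : Fin d) :
    rowNorm (X.transpose * M) i ≤ rowNorm X.transpose i * √(∑ j, rowNorm M j ^ 2) := by
  have hX : rowNorm X.transpose i = √(∑ j, ‖X j i‖ ^ 2) := by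
    simp [rowNorm, EuclideanSpace.norm_eq]
  rw [hX]
  calc rowNorm (X.transpose * M) i = ‖∑ j, X j i • row M j‖ :=
        congrArg norm (row_mul X.transpose M i)
    _ ≤ ∑ j, ‖X j i‖ * rowNorm M j :=
        (norm_sum_le _ _).trans_eq (sum_congr rfl fun j _ => norm_smul _ _)
    _ ≤ _ := Real.sum_mul_le_sqrt_mul_sqrt _ _ _

lemma rowNorm_add_le {m : ℕ} (M N : Matrix (Fin m) (Fin q) ℝ) (i : Fin m) :
    rowNorm (M + N) i ≤ rowNorm M i + rowNorm N i :=
  norm_add_le (row M i) (row N i)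

end Rows

/-! ### Safety of the screening test -/

section Model

variable {n d q : ℕ} {X : Matrix (Fin n) (Fin d) ℝ} {f : Fin n → EuclideanSpace ℝ (Fin q) → ℝ}
  {L : ℝ} {lam : Fin d → ℝ} {A : Finset (Fin d)}

/-- The matrix of the gradients of the `f_j` at the rows of `X B`. -/
noncomputable def gradientMatrix (X : Matrix (Fin n) (Fin d) ℝ)
    (f : Fin n → EuclideanSpace ℝ (Fin q) → ℝ) (B : Matrix (Fin d) (Fin q) ℝ) :
    Matrix (Fin n) (Fin q) ℝ :=
  fun j => (gradient (f j) (row (X * B) j)).ofLp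

lemma primal_eq_of_mem_supportedOn {B : Matrix (Fin d) (Fin q) ℝ} (hB : B ∈ supportedOn q A) :
    primal X f lam B = loss X f B + owlSum (topWeights lam A) (subvector A (rowNorm B)) := by
  rw [primal, owlSum_eq_of_support lam (rowNorm_nonneg B) fun i hi => rowNorm_eq_zero.2 (hB i hi)]

lemma reassigned_eq_primal {B : Matrix (Fin d) (Fin q) ℝ} (hB : B ∈ supportedOn q A)
    (τ : Equiv.Perm (Fin d)) : reassigned X f lam A τ B = primal X f lam B := by
  rw [primal_eq_of_mem_supportedOn hB, reassigned, add_eq_left]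
  refine sum_eq_zero fun i hi => ?_
  rw [rowNorm_eq_zero.2 (hB i (mem_compl.1 hi)), mul_zero]

/-- Weak duality of the penalty: the pairing with a dual feasible matrix is bounded below. -/
lemma neg_owlSum_le_sum_inner {B : Matrix (Fin d) (Fin q) ℝ} {Θ : Matrix (Fin n) (Fin q) ℝ}
    (hB : B ∈ supportedOn q A) (hΘ : DualFeasible X lam A Θ) :
    -owlSum (topWeights lam A) (subvector A (rowNorm B)) ≤
      ∑ j, inner ℝ (row (X * B) j) (row Θ j) := by
  have h := sum_mul_le_owlSum (v := subvector A (rowNorm B)) (fun j => rowNorm_nonneg B _) hΘ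
  have hsum : ∑ j, subvector A (rowNorm B) j * subvector A (rowNorm (X.transpose * Θ)) j =
      ∑ i, rowNorm B i * rowNorm (X.transpose * Θ) i := by
    rw [← sum_subset (subset_univ A) fun i _ hi => by rw [rowNorm_eq_zero.2 (hB i hi), zero_mul]]
    exact sum_subvector A fun i => rowNorm B i * rowNorm (X.transpose * Θ) i
  rw [hsum] at h
  rw [sum_inner_row_mul]
  refine (neg_le_neg h).trans ?_
  rw [← sum_neg_distrib]
  exact sum_le_sum fun i _ => neg_le_of_abs_le (abs_real_inner_le_norm _ _)

/-- Evaluating each conjugate at one point bounds it below by a real number, so neither finiteness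
nor attainment of the suprema is needed. -/
lemma coe_sub_le_gap (B : Matrix (Fin d) (Fin q) ℝ) (Θ : Matrix (Fin n) (Fin q) ℝ)
    (z : Fin n → EuclideanSpace ℝ (Fin q)) :
    ((primal X f lam B + ∑ j, (inner ℝ (z j) (row Θ j) - f j (z j)) : ℝ) : EReal) ≤
      gap X f lam B Θ := by
  have hcoe : ∀ g : Fin n → ℝ, ((∑ j, g j : ℝ) : EReal) = ∑ j, (g j : EReal) := fun g =>
    map_sum (⟨⟨fun x : ℝ => (x : EReal), EReal.coe_zero⟩, EReal.coe_add⟩ : ℝ →+ EReal) g univ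
  have hdual : dual f Θ ≤ ((∑ j, -(inner ℝ (z j) (row Θ j) - f j (z j)) : ℝ) : EReal) := by
    rw [hcoe]
    refine sum_le_sum fun j _ => ?_
    rw [EReal.coe_neg, EReal.neg_le_neg_iff]
    exact le_iSup (fun z => ((inner ℝ z (row Θ j) - f j z : ℝ) : EReal)) (z j)
  refine le_trans (le_of_eq ?_) (EReal.sub_le_sub le_rfl hdual)
  rw [← EReal.coe_sub, sum_neg_distrib, sub_neg_eq_add]

/-- The duality gap controls the distance of a dual feasible matrix to the gradients at a
minimizer. -/
lemma sum_sq_rowNorm_sub_gradientMatrix_le (hL : 0 < L) (hdiff : ∀ j, Differentiable ℝ (f j))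
    (hlip : ∀ j z w, ‖gradient (f j) z - gradient (f j) w‖ ≤ 1 / L * ‖z - w‖)
    {B C : Matrix (Fin d) (Fin q) ℝ} {Θ : Matrix (Fin n) (Fin q) ℝ} {g : ℝ}
    (hC : C ∈ supportedOn q A) (hmin : primal X f lam C ≤ primal X f lam B)
    (hΘ : DualFeasible X lam A Θ) (hg : gap X f lam B Θ = g) :
    ∑ j, rowNorm (Θ - gradientMatrix X f C) j ^ 2 ≤ 2 * g / L := by
  choose z hz using fun j => exists_inner_sub_ge hL (hdiff j) (hlip j) (row (X * C) j) (row Θ j)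
  have h1 : primal X f lam B + ∑ j, (inner ℝ (z j) (row Θ j) - f j (z j)) ≤ g := by
    have := coe_sub_le_gap (X := X) (f := f) (lam := lam) B Θ z
    rw [hg] at this
    exact_mod_cast this
  have h2 := sum_le_sum fun j (_ : j ∈ univ) => hz j
  rw [sum_add_distrib, sum_sub_distrib, ← mul_sum] at h2
  have h3 := neg_owlSum_le_sum_inner hC hΘ
  rw [primal_eq_of_mem_supportedOn hC, loss] at hmin
  -- The losses at `C` cancel between `h2` and `hmin`, and `h3` absorbs the penalty of `C`.
  have h4 : L / 2 * ∑ j, rowNorm (Θ - gradientMatrix X f C) j ^ 2 ≤ g := by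
    change L / 2 * ∑ j, ‖row Θ j - gradient (f j) (row (X * C) j)‖ ^ 2 ≤ g
    linarith
  rw [le_div_iff₀ hL]
  linarith

lemma loss_add_le (hdiff : ∀ j, Differentiable ℝ (f j))
    (hlip : ∀ j z w, ‖gradient (f j) z - gradient (f j) w‖ ≤ 1 / L * ‖z - w‖)
    (B D : Matrix (Fin d) (Fin q) ℝ) :
    loss X f (B + D) ≤ loss X f B +
      ∑ i, inner ℝ (row D i) (row (X.transpose * gradientMatrix X f B) i) +
      1 / L / 2 * ∑ j, rowNorm (X * D) j ^ 2 := by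
  rw [← sum_inner_row_mul, loss, loss, mul_sum, ← sum_add_distrib, ← sum_add_distrib]
  refine sum_le_sum fun j _ => ?_
  have h := le_add_inner_gradient_add_sq (hdiff j) (hlip j) (row (X * B) j) (row (X * D) j)
  rw [real_inner_comm] at h
  rw [Matrix.mul_add]
  exact h

/-- A feature whose correlation with the gradients at a minimizer is below the smallest active
weight is inactive. -/
lemma row_eq_zero_of_rowNorm_lt (hL : 0 < L) (hdiff : ∀ j, Differentiable ℝ (f j))
    (hlip : ∀ j z w, ‖gradient (f j) z - gradient (f j) w‖ ≤ 1 / L * ‖z - w‖)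
    (hanti : Antitone lam) {C : Matrix (Fin d) (Fin q) ℝ} (hC : C ∈ supportedOn q A)
    (hmin : IsMinOn (primal X f lam) Set.univ C) {i : Fin d} (hi : i ∈ A)
    (hlt : rowNorm (X.transpose * gradientMatrix X f C) i < testWeight lam A i) : C i = 0 := by
  by_contra hne
  have hpos : 0 < rowNorm C i := (rowNorm_nonneg C i).lt_of_ne' (mt rowNorm_eq_zero.1 hne)
  set ν := rowNorm (X.transpose * gradientMatrix X f C) i
  -- Moving along `E` scales row `i` by `1 - s` and fixes all other rows.
  obtain ⟨E, hEi, hEne⟩ : ∃ E : Matrix (Fin d) (Fin q) ℝ, E i = -C i ∧ ∀ k, k ≠ i → E k = 0 :=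
    ⟨Matrix.updateRow 0 i (-C i), Matrix.updateRow_self, fun k hk => Matrix.updateRow_ne hk⟩
  obtain ⟨K, hKdef⟩ : ∃ K, K = 1 / L / 2 * ∑ j, rowNorm (X * E) j ^ 2 := ⟨_, rfl⟩
  have hK : 0 ≤ K := hKdef ▸ mul_nonneg (by positivity) (sum_nonneg fun j _ => sq_nonneg _)
  have key : ∀ s : ℝ, 0 ≤ s → s ≤ 1 →
      s * (rowNorm C i * (testWeight lam A i - ν)) ≤ s ^ 2 * K := by
    intro s hs0 hs1
    have hrow : ∀ k, k ≠ i → (C + s • E) k = C k := fun k hk => by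
      change C k + s • E k = C k
      rw [hEne k hk, smul_zero, add_zero]
    have hnorm : ∀ k, k ≠ i → rowNorm (C + s • E) k = rowNorm C k := fun k hk => by
      rw [rowNorm, hrow k hk, rowNorm]
    have hnormi : rowNorm (C + s • E) i = (1 - s) * rowNorm C i := by
      have : row (C + s • E) i = (1 - s) • row C i := by
        ext k
        simp [hEi]
        ring
      change ‖row (C + s • E) i‖ = _
      rw [this, norm_smul, Real.norm_of_nonneg (sub_nonneg.2 hs1)]
      rfl
    have hsupp : C + s • E ∈ supportedOn q A := fun k hk => by
      rw [hrow k fun h => hk (h ▸ hi), hC k hk]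
    have h1 : primal X f lam C ≤ primal X f lam (C + s • E) := hmin (Set.mem_univ _)
    rw [primal_eq_of_mem_supportedOn hC, primal_eq_of_mem_supportedOn hsupp] at h1
    have h2 := loss_add_le (X := X) hdiff hlip C (s • E)
    have h3 : ∑ k, inner ℝ (row (s • E) k) (row (X.transpose * gradientMatrix X f C) k) ≤
        s * (rowNorm C i * ν) := by
      rw [sum_eq_single i]
      · have hr : row (s • E) i = s • -row C i := by
          ext k
          simp [hEi]
        rw [hr, real_inner_smul_left]
        refine mul_le_mul_of_nonneg_left ?_ hs0
        refine (real_inner_le_norm _ _).trans_eq ?_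
        rw [norm_neg]
        rfl
      · intro k _ hk
        have hr : row (s • E) k = 0 := by
          ext l
          simp [hEne k hk]
        rw [hr, inner_zero_left]
      · simp
    have h4 : 1 / L / 2 * ∑ j, rowNorm (X * (s • E)) j ^ 2 = s ^ 2 * K := by
      simp only [hKdef, mul_left_comm (s ^ 2), mul_sum]
      refine sum_congr rfl fun j _ => ?_
      have hr : row (X * (s • E)) j = s • row (X * E) j := by
        rw [Matrix.mul_smul]
        rfl
      have : rowNorm (X * (s • E)) j = s * rowNorm (X * E) j := by
        change ‖row (X * (s • E)) j‖ = _
        rw [hr, norm_smul, Real.norm_of_nonneg hs0]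
        rfl
      rw [this]
      ring
    -- The order of the rows may change, but every active weight is at least the test weight, so the
    -- saving is at least that weight times `s * rowNorm C i`.
    have h5 := owlSum_add_mul_le (antitone_topWeights hanti A)
      (testWeight_le_topWeights hanti A i)
      (v := subvector A (rowNorm (C + s • E))) (v' := subvector A (rowNorm C)) (by
        intro j
        simp only [subvector]
        by_cases hj : A.orderEmbOfFin rfl j = i
        · rw [hj, hnormi]
          nlinarith
        · rw [hnorm _ hj])
    rw [sum_subvector, sum_subvector, ← sum_sub_distrib, sum_eq_single_of_mem i hi
      (fun k _ hk => by rw [hnorm k hk, sub_self]), hnormi] at h5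
    linarith
  set δ := rowNorm C i * (testWeight lam A i - ν)
  have hδ : 0 < δ := mul_pos hpos (sub_pos.2 hlt)
  have hδK : 0 < δ + K := by linarith
  -- `key` gives δ ≤ s K for s > 0; this s lies in (0, 1] and has s K < δ, even if K = 0.
  have h := key (δ / (δ + K)) (by positivity) ((div_le_one hδK).2 (by linarith))
  rw [pow_two, mul_assoc] at h
  have h' := le_of_mul_le_mul_left h (by positivity)
  rw [div_mul_eq_mul_div, le_div_iff₀ hδK] at h'
  nlinarith

/-- The radius term of the test pays, by the triangle inequality, for replacing `Θ` with the unknown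
gradients at `C`. -/
lemma row_eq_zero_of_screeningTest (hL : 0 < L) (hdiff : ∀ j, Differentiable ℝ (f j))
    (hlip : ∀ j z w, ‖gradient (f j) z - gradient (f j) w‖ ≤ 1 / L * ‖z - w‖)
    (hanti : Antitone lam) {B C : Matrix (Fin d) (Fin q) ℝ} {Θ : Matrix (Fin n) (Fin q) ℝ}
    (hC : C ∈ supportedOn q A) (hmin : IsMinOn (primal X f lam) Set.univ C)
    (hΘ : DualFeasible X lam A Θ) {i : Fin d} (hi : i ∈ A)
    (htest : ScreeningTest X f L lam A B Θ i) : C i = 0 := by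
  obtain ⟨g, hg, hlt⟩ := htest
  refine row_eq_zero_of_rowNorm_lt hL hdiff hlip hanti hC hmin hi (lt_of_le_of_lt ?_ hlt)
  have hdist := sum_sq_rowNorm_sub_gradientMatrix_le hL hdiff hlip hC (hmin (Set.mem_univ B)) hΘ hg
  have h1 := rowNorm_transpose_mul_le X (gradientMatrix X f C - Θ) i
  have h2 : ∀ j, rowNorm (gradientMatrix X f C - Θ) j = rowNorm (Θ - gradientMatrix X f C) j :=
    fun j => norm_sub_rev (row (gradientMatrix X f C) j) (row Θ j)
  simp only [h2] at h1
  have h3 := rowNorm_add_le (X.transpose * Θ) (X.transpose * (gradientMatrix X f C - Θ)) i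
  rw [← Matrix.mul_add, add_sub_cancel] at h3
  have h4 := mul_le_mul_of_nonneg_left (Real.sqrt_le_sqrt hdist) (rowNorm_nonneg X.transpose i)
  linarith

/-- Every minimizer vanishes outside every active set. -/
lemma mem_supportedOn_activeSet (hL : 0 < L) (hdiff : ∀ j, Differentiable ℝ (f j))
    (hlip : ∀ j z w, ‖gradient (f j) z - gradient (f j) w‖ ≤ 1 / L * ‖z - w‖)
    (hanti : Antitone lam) {B : ℕ → Matrix (Fin d) (Fin q) ℝ} {Θ : ℕ → Matrix (Fin n) (Fin q) ℝ}
    (hΘ : ∀ t, DualFeasible X lam (activeSet X f L lam B Θ t) (Θ t))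
    {C : Matrix (Fin d) (Fin q) ℝ} (hmin : IsMinOn (primal X f lam) Set.univ C) (t : ℕ) :
    C ∈ supportedOn q (activeSet X f L lam B Θ t) := by
  induction t with
  | zero => exact fun i hi => absurd (mem_univ i) hi
  | succ t ih =>
    intro i hi
    by_cases hit : i ∈ activeSet X f L lam B Θ t
    · refine row_eq_zero_of_screeningTest hL hdiff hlip hanti ih hmin (hΘ t) hit (B := B t) ?_
      by_contra htest
      exact hi (by classical exact mem_filter.2 ⟨hit, htest⟩)
    · exact ih i hit

end Model

end GroupOWL

theorem mainTheorem1 {n d q : ℕ} (X : Matrix (Fin n) (Fin d) ℝ)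
    (f : Fin n → EuclideanSpace ℝ (Fin q) → ℝ) (L : ℝ) (hL : 0 < L)
    (hconv : ∀ j, ConvexOn ℝ Set.univ (f j))
    (hdiff : ∀ j, Differentiable ℝ (f j))
    (hlip : ∀ j z w, ‖gradient (f j) z - gradient (f j) w‖ ≤ 1 / L * ‖z - w‖)
    (lam : Fin d → ℝ) (hanti : Antitone lam) (hnonneg : ∀ i, 0 ≤ lam i)
    (B : ℕ → Matrix (Fin d) (Fin q) ℝ) (Θ : ℕ → Matrix (Fin n) (Fin q) ℝ)
    (hΘ : ∀ t, GroupOWL.DualFeasible X lam (GroupOWL.activeSet X f L lam B Θ t) (Θ t))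
    (Bstar : Matrix (Fin d) (Fin q) ℝ)
    (hBstar : IsMinOn (GroupOWL.primal X f lam) Set.univ Bstar) (t : ℕ) :
    (∀ i, i ∉ GroupOWL.activeSet X f L lam B Θ t → Bstar i = 0) ∧
    (∀ τ : Equiv.Perm (Fin d),
      (∀ i, i ∉ GroupOWL.activeSet X f L lam B Θ t →
        (GroupOWL.activeSet X f L lam B Θ t).card ≤ (τ i : ℕ)) →
      {C | IsMinOn (GroupOWL.primal X f lam) Set.univ C} =
        {C | C ∈ GroupOWL.supportedOn q (GroupOWL.activeSet X f L lam B Θ t) ∧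
          IsMinOn (GroupOWL.reassigned X f lam (GroupOWL.activeSet X f L lam B Θ t) τ)
            (GroupOWL.supportedOn q (GroupOWL.activeSet X f L lam B Θ t)) C}) := by
  have hsupp : ∀ C, IsMinOn (GroupOWL.primal X f lam) Set.univ C →
      C ∈ GroupOWL.supportedOn q (GroupOWL.activeSet X f L lam B Θ t) := fun C hC =>
    GroupOWL.mem_supportedOn_activeSet hL hdiff hlip hanti hΘ hC t
  refine ⟨hsupp Bstar hBstar, fun τ _ => Set.ext fun C => ⟨fun hC => ⟨hsupp C hC, ?_⟩, ?_⟩⟩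
  · intro D hD
    change GroupOWL.reassigned _ _ _ _ _ _ ≤ GroupOWL.reassigned _ _ _ _ _ _
    rw [GroupOWL.reassigned_eq_primal (hsupp C hC), GroupOWL.reassigned_eq_primal hD]
    exact hC (Set.mem_univ D)
  · rintro ⟨hC, hmin⟩ D hD
    -- `Bstar` is a competitor in the restricted problem, so `C` attains the global minimum.
    have h : GroupOWL.reassigned _ _ _ _ _ _ ≤ GroupOWL.reassigned _ _ _ _ _ _ :=
      hmin (hsupp Bstar hBstar)
    rw [GroupOWL.reassigned_eq_primal hC, GroupOWL.reassigned_eq_primal (hsupp Bstar hBstar)] at h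
    exact h.trans (hBstar hD)
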